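/- A \emph{ringed finite space} is a ringed space $(X,\mathcal{O}_X)$ (a topological space $X$ with a sheaf $\mathcal{O}_X$ of commutative unital rings) whose underlying topological space has finitely many points. Let $I=[0,1]$ be the unit interval. For a ringed space $X$, let $X\times I$ be the ringed space whose underlying space is the topological product, with structure sheaf $\mathcal{O}_{X\times I}=\pi_X^{-1}\mathcal{O}_X$, where $\pi_X\colon X\times I\to X$ is the projection; for $t\in I$ let $i_t\colon X\to X\times I$ be the morphism of ringed spaces given by $x\mapsto (x,t)$ and by the identity $i_t^{-1}\mathcal{O}_{X\times I}=\mathcal{O}_X\to\mathcal{O}_X$. Two morphisms of ringed spaces $f,g\colon X\to Y$ are \emph{homotopic}, $f\sim g$, if there is a morphism of ringed spaces $H\colon X\times I\to Y$ with $H\circ i_0=f$ and $H\circ i_1=g$. Two ringed spaces $X$ and $Y$ are \emph{homotopy equivalent} if there are morphisms of ringed spaces $f\colon X\to Y$ and $g\colon Y\to X$ such that $g\circ f\sim \mathrm{Id}_X$ and $f\circ g\sim \mathrm{Id}_Y$. A sheaf of $\mathcal{O}_X$-modules $\mathcal{M}$ is \emph{quasi-coherent} if every $x\in X$ has an open neighbourhood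 $U$ for which there are sets $A,B$ and an exact sequence $\mathcal{O}_{X|U}^{(A)}\to\mathcal{O}_{X|U}^{(B)}\to\mathcal{M}_{|U}\to 0$ of $\mathcal{O}_{X|U}$-modules, where $\mathcal{O}_{X|U}^{(A)}$ denotes the direct sum of copies of $\mathcal{O}_{X|U}$ indexed by $A$. \textbf{Theorem.} If $X$ and $Y$ are homotopy equivalent ringed finite spaces, then the category of quasi-coherent $\mathcal{O}_X$-modules (with all morphisms of $\mathcal{O}_X$-modules) is equivalent to the category of quasi-coherent $\mathcal{O}_Y$-modules. That is, the category of quasi-coherent modules on a ringed finite space is, up to equivalence, a homotopy invariant. -/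

import Mathlib

open CategoryTheory TopologicalSpace Opposite AlgebraicGeometry

universe u

namespace RingedFinite

noncomputable section

/-- A ringed finite space is a ringed space whose underlying topological space is finite. -/
abbrev IsRingedFiniteSpace (X : RingedSpace.{u, u}) : Prop := Finite X.carrier

/-- The topological space `X × I`, where `I = [0, 1]` is the unit interval. -/
abbrev cylTop (X : RingedSpace.{u, u}) : TopCat.{u} := TopCat.of (X.carrier × unitInterval)

/-- The projection `π_X : X × I → X`. -/
def cylProj (X : RingedSpace.{u, u}) : cylTop X ⟶ X.carrier :=
  TopCat.ofHom (ContinuousMap.fst)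

/-- The continuous map `X → X × I`, `x ↦ (x, t)`. -/
def cylIncl (X : RingedSpace.{u, u}) (t : unitInterval) : X.carrier ⟶ cylTop X :=
  TopCat.ofHom ((ContinuousMap.id _).prodMk (ContinuousMap.const _ t))

/-- The sheaf of rings `π_X⁻¹ 𝒪_X` on `X × I`. -/
def cylSheaf (X : RingedSpace.{u, u}) : TopCat.Sheaf CommRingCat.{u} (cylTop X) :=
  (TopCat.Sheaf.pullback CommRingCat.{u} (cylProj X)).obj X.sheaf

/-- The ringed space `X × I`: the product of `X` with the unit interval, with structure sheaf
`π_X⁻¹ 𝒪_X`. -/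
def cyl (X : RingedSpace.{u, u}) : RingedSpace.{u, u} where
  carrier := cylTop X
  presheaf := (cylSheaf X).obj
  IsSheaf := (cylSheaf X).property

/-- The morphism of sheaves `π_X⁻¹ 𝒪_X ⟶ (i_t)_* 𝒪_X` corresponding, under the adjunction between
`π_X⁻¹` and `(π_X)_*`, to the identity `𝒪_X ⟶ (π_X)_* (i_t)_* 𝒪_X = 𝒪_X`. -/
def cylInclSharp (X : RingedSpace.{u, u}) (t : unitInterval) :
    cylSheaf X ⟶ (TopCat.Sheaf.pushforward CommRingCat.{u} (cylIncl X t)).obj X.sheaf :=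
  ((TopCat.Sheaf.pullbackPushforwardAdjunction CommRingCat.{u} (cylProj X)).homEquiv
    X.sheaf ((TopCat.Sheaf.pushforward CommRingCat.{u} (cylIncl X t)).obj X.sheaf)).symm
    (𝟙 X.sheaf)

/-- The morphism of ringed spaces `i_t : X → X × I`, `x ↦ (x, t)`. -/
def incl (X : RingedSpace.{u, u}) (t : unitInterval) : X ⟶ cyl X :=
  InducedCategory.homMk { base := cylIncl X t, c := (cylInclSharp X t).hom }

/-- Two morphisms of ringed spaces `f, g : X → Y` are homotopic if there is a morphism of ringed
spaces `H : X × I → Y` with `H ∘ i_0 = f` and `H ∘ i_1 = g`. -/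
def Homotopic {X Y : RingedSpace.{u, u}} (f g : X ⟶ Y) : Prop :=
  ∃ H : cyl X ⟶ Y, incl X 0 ≫ H = f ∧ incl X 1 ≫ H = g

/-- Two ringed spaces `X` and `Y` are homotopy equivalent if there are morphisms `f : X → Y` and
`g : Y → X` such that `g ∘ f` and `f ∘ g` are homotopic to the identities. -/
def HomotopyEquivalent (X Y : RingedSpace.{u, u}) : Prop :=
  ∃ (f : X ⟶ Y) (g : Y ⟶ X), Homotopic (f ≫ g) (𝟙 X) ∧ Homotopic (g ≫ f) (𝟙 Y)

/-- The structure sheaf of a ringed space, as a sheaf of (not necessarily commutative) rings. -/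
abbrev ringCatSheaf (X : RingedSpace.{u, u}) :
    Sheaf (Opens.grothendieckTopology X.carrier) RingCat.{u} :=
  (sheafCompose _ (forget₂ CommRingCat.{u} RingCat.{u})).obj X.sheaf

/-- The category of quasi-coherent modules on a ringed space: the full subcategory of the category
of sheaves of `𝒪_X`-modules on those that are locally a cokernel of a morphism between
(arbitrary) direct sums of copies of `𝒪_X`. -/
abbrev QCoh (X : RingedSpace.{u, u}) :=
  (SheafOfModules.isQuasicoherent.{u} (ringCatSheaf X)).FullSubcategory

end

end RingedFinite

/-! Inverse image is functorial, so it suffices that homotopic morphisms `f`, `g` between ringed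
finite spaces induce isomorphic functors on quasi-coherent modules. Since `Y` is finite, each `H (x,
t)` has a smallest open neighbourhood; since `X` is finite, `H (x, t')` lies in it for every `x` at
once when `t'` is near `t`. Sections of `π⁻¹ 𝒪_X` have constant germs along connected pieces of `{x}
× I`, so `H_t` is then `H_t'` followed by restriction of sections
(`eventually_dominated_incl_comp`). Such a domination gives a map of direct images and, by
adjunction, a natural map of inverse images. It is an isomorphism on `𝒪_Y`; both functors preserve
colimits, so it is one on every locally presented module (`Dominated.isIso_pullbackHom_app`).
Connectedness of `I` then links `0` to `1`. -/

/-! ### Reflections and local objects -/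

section Reflection

open Limits

variable {A B V : Type*} [Category* A] [Category* B] [Category* V]
  {jl : A ⥤ V} {jr : V ⥤ A} (adj : jl ⊣ jr) [jr.Full] [jr.Faithful]
  {L : A ⥤ B} {R : B ⥤ A} (adj' : L ⊣ R)

omit [jr.Faithful] in
/-- Morphisms to a local object factor uniquely through the unit of a reflection. -/
lemma bijective_unit_comp_of_isIso_unit (N Z : A) [IsIso (adj.unit.app Z)] :
    Function.Bijective (fun g : jr.obj (jl.obj N) ⟶ Z ↦ adj.unit.app N ≫ g) := by
  constructor
  · intro g g' h
    obtain ⟨f, hf⟩ := jr.map_surjective (g ≫ adj.unit.app Z)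
    obtain ⟨f', hf'⟩ := jr.map_surjective (g' ≫ adj.unit.app Z)
    have : f = f' := by
      apply (adj.homEquiv N (jl.obj Z)).injective
      simp only [Adjunction.homEquiv_unit, hf, hf']
      simp [reassoc_of% h]
    rw [← cancel_mono (adj.unit.app Z), ← hf, ← hf', this]
  · intro k
    refine ⟨jr.map (jl.map k) ≫ inv (adj.unit.app Z), ?_⟩
    simp

omit [jr.Faithful] in
include adj' in
/-- If the right adjoint `R` of `L` takes values in local objects for the reflection `jl ⊣ jr`,
then `L` inverts the unit of this reflection. -/
lemma isIso_map_unit_of_isIso_unit (h : ∀ K, IsIso (adj.unit.app (R.obj K))) (N : A) :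
    IsIso (L.map (adj.unit.app N)) := by
  rw [isIso_iff_coyoneda_map_bijective]
  intro K
  have := h K
  rw [← ((adj'.homEquiv _ _).bijective.of_comp_iff' _)]
  convert! (bijective_unit_comp_of_isIso_unit adj N (R.obj K)).comp
    (adj'.homEquiv _ _).bijective using 1
  ext g : 1
  simp [Adjunction.homEquiv_unit]

/-- If the right adjoint `R` of `L` takes values in local objects for the reflection `jl ⊣ jr`,
then the restriction of `L` to local objects is left adjoint to `R ⋙ jl`. -/
noncomputable def adjunctionOfIsIsoUnit (h : ∀ K, IsIso (adj.unit.app (R.obj K))) :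
    jr ⋙ L ⊣ R ⋙ jl :=
  adj'.restrictFullyFaithful (.ofFullyFaithful jr) (Functor.FullyFaithful.id _)
    (Iso.refl _)
    (@asIso _ _ _ _ (Functor.whiskerLeft R adj.unit) (by
      rw [NatTrans.isIso_iff_isIso_app]; exact h))

end Reflection

lemma SheafOfModules.isIso_of_isIso_app {C : Type*} [Category* C] {J : GrothendieckTopology C}
    {R : Sheaf J RingCat.{u}} {M N : SheafOfModules.{u} R} (φ : M ⟶ N)
    (h : ∀ U, IsIso (φ.val.app U)) : IsIso φ := by
  have : IsIso ((SheafOfModules.forget R).map φ) :=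
    (PresheafOfModules.isoMk (fun U ↦ @asIso _ _ _ _ (φ.val.app U) (h U))
      (fun _ _ f ↦ φ.val.naturality f)).isIso_hom
  exact isIso_of_reflects_iso φ (SheafOfModules.forget R)

lemma PresheafOfModules.bijective_map_of_isIso {C : Type*} [Category* C]
    {R : Cᵒᵖ ⥤ RingCat.{u}} (M : PresheafOfModules.{u} R) {U V : Cᵒᵖ} (f : U ⟶ V) [IsIso f] :
    Function.Bijective (M.map f) := by
  have : IsIso (M.presheaf.map f) := inferInstance
  exact (ConcreteCategory.isIso_iff_bijective (M.presheaf.map f)).1 this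

/-! ### Inverse image, direct image and restriction of modules -/

namespace RingedFinite

noncomputable section

instance isRightAdjoint_presheafPushforward {C D : Type u} [SmallCategory C] [SmallCategory D]
    (F : C ⥤ D) {J : GrothendieckTopology C} {K : GrothendieckTopology D} [F.IsContinuous J K]
    {S : Sheaf J RingCat.{u}} {R : Sheaf K RingCat.{u}}
    (φ : S ⟶ (F.sheafPushforwardContinuous RingCat.{u} J K).obj R) :
    (PresheafOfModules.pushforward.{u} (F := F) φ.hom).IsRightAdjoint :=
  PresheafOfModules.instIsRightAdjointPushforward (F := F) (R := R.obj) (S := S.obj) φ.hom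

variable {X Y Z : RingedSpace.{u, u}}

/-- The morphism of sheaves of rings `𝒪_Y ⟶ f_* 𝒪_X` attached to a morphism of ringed spaces. -/
def toRingCatSheafHom (f : X ⟶ Y) :
    ringCatSheaf Y ⟶ ((Opens.map f.hom.base).sheafPushforwardContinuous
      RingCat.{u} _ _).obj (ringCatSheaf X) where
  hom := Functor.whiskerRight f.hom.c _

/-- The category of sheaves of modules on a ringed space. -/
abbrev Mod (X : RingedSpace.{u, u}) := SheafOfModules.{u} (ringCatSheaf X)

/-- The direct image of sheaves of modules. -/
abbrev pushforward (f : X ⟶ Y) : Mod X ⥤ Mod Y :=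
  SheafOfModules.pushforward (toRingCatSheafHom f)

/-- The inverse image of sheaves of modules. -/
abbrev pullback (f : X ⟶ Y) : Mod Y ⥤ Mod X :=
  SheafOfModules.pullback (toRingCatSheafHom f)

/-- The adjunction between inverse and direct image. -/
abbrev pullbackPushforwardAdjunction (f : X ⟶ Y) : pullback f ⊣ pushforward f :=
  SheafOfModules.pullbackPushforwardAdjunction (toRingCatSheafHom f)

/-- Inverse image along the identity. -/
def pullbackId : pullback (𝟙 X) ≅ 𝟭 _ :=
  SheafOfModules.pullbackId (ringCatSheaf X)

/-- Inverse image along a composition. -/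
def pullbackComp (f : X ⟶ Y) (g : Y ⟶ Z) : pullback g ⋙ pullback f ≅ pullback (f ≫ g) :=
  SheafOfModules.pullbackComp (toRingCatSheafHom g) (toRingCatSheafHom f)

/-- The preimage of the whole space is the whole space. Finality is what makes the canonical map
`f^* 𝒪_Y ⟶ 𝒪_X` an isomorphism. -/
instance final_opensMap (f : X ⟶ Y) : (Opens.map f.hom.base).Final := by
  have : Limits.PreservesLimit (Functor.empty.{0} _) (Opens.map f.hom.base) :=
    Limits.preservesTerminal_of_iso _
      ((Opens.map f.hom.base).mapIso (Limits.terminalIsTerminal.uniqueUpToIso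
        (Limits.isTerminalTop)) ≪≫ Limits.isTerminalTop.uniqueUpToIso Limits.terminalIsTerminal)
  infer_instance

/-- Restriction of sheaves of modules to an open subset. -/
abbrev res (V : Opens X) : Mod X ⥤ SheafOfModules.{u} ((ringCatSheaf X).over V) :=
  SheafOfModules.overFunctor (ringCatSheaf X) V

/-- Direct image of sheaves of modules from an open subset. -/
abbrev ext (V : Opens X) : SheafOfModules.{u} ((ringCatSheaf X).over V) ⥤ Mod X :=
  SheafOfModules.pushforward (SheafOfModules.pushforwardOver V)

/-- Restriction to an open subset is left adjoint to direct image. -/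
abbrev resExtAdj (V : Opens X) : res V ⊣ ext V := SheafOfModules.overPushforwardOverAdj V

instance (V : Opens X) : IsIso (resExtAdj V).counit := by
  rw [NatTrans.isIso_iff_isIso_app]
  intro M
  apply SheafOfModules.isIso_of_isIso_app
  intro U
  rw [ConcreteCategory.isIso_iff_bijective]
  have : IsIso ((Over.forgetAdjStar V).unit.app U.unop) :=
    ⟨Over.homMk Limits.prod.snd (Subsingleton.elim _ _),
      by ext; exact Subsingleton.elim _ _, by ext; exact Subsingleton.elim _ _⟩
  exact M.val.bijective_map_of_isIso ((Over.forgetAdjStar V).unit.app U.unop).op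

instance (V : Opens X) : (ext V).Full :=
  ((resExtAdj V).fullyFaithfulROfIsIsoCounit).full
instance (V : Opens X) : (ext V).Faithful :=
  ((resExtAdj V).fullyFaithfulROfIsIsoCounit).faithful

/-- At `U` the unit restricts sections of `K` from `W ∩ f⁻¹ U` to `W ∩ f⁻¹ (V ∩ U)`, and these opens
coincide because `W ⊆ f⁻¹ V`. -/
lemma isIso_unit_pushforward (f : X ⟶ Y) (V : Opens Y) (W : Opens X)
    (h : W ≤ (Opens.map f.hom.base).obj V) (K) :
    IsIso ((resExtAdj V).unit.app ((ext W ⋙ pushforward f).obj K)) := by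
  apply SheafOfModules.isIso_of_isIso_app
  intro U
  rw [ConcreteCategory.isIso_iff_bijective]
  let i := (Over.star W).map ((Opens.map f.hom.base).map ((Over.forgetAdjStar V).counit.app U.unop))
  have h₁ : Limits.prod W ((Opens.map f.hom.base).obj U.unop) ≤ W :=
    leOfHom Limits.prod.fst
  have h₂ : Limits.prod W ((Opens.map f.hom.base).obj U.unop) ≤
      (Opens.map f.hom.base).obj U.unop :=
    leOfHom Limits.prod.snd
  have h₃ : V ⊓ U.unop ≤ Limits.prod V U.unop :=
    leOfHom (Limits.prod.lift (homOfLE inf_le_left) (homOfLE inf_le_right))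
  have hle : Limits.prod W ((Opens.map f.hom.base).obj U.unop) ≤
      Limits.prod W ((Opens.map f.hom.base).obj (Limits.prod V U.unop)) :=
    leOfHom (Limits.prod.lift (homOfLE h₁) (homOfLE fun _ hx ↦ h₃ ⟨h (h₁ hx), h₂ hx⟩))
  have : IsIso i := by
    refine ⟨Over.homMk (homOfLE hle) (Subsingleton.elim _ _),
      by ext; exact Subsingleton.elim _ _, by ext; exact Subsingleton.elim _ _⟩
  exact K.val.bijective_map_of_isIso i.op

end

end RingedFinite

/-! ### Inverse images preserve quasi-coherence -/

namespace RingedFinite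

noncomputable section

variable {X Y Z : RingedSpace.{u, u}}

section

variable (f : X ⟶ Y) {V : Opens Y} {W : Opens X}

/-- Inverse image followed by restriction to an open subset. -/
abbrev pullbackRes (W : Opens X) := pullback f ⋙ res W

/-- The right adjoint of inverse image followed by restriction. -/
abbrev pullbackResAdj (W : Opens X) : pullbackRes f W ⊣ ext W ⋙ pushforward f :=
  (pullbackPushforwardAdjunction f).comp (resExtAdj W)

/-- The inverse image along a morphism `W ⟶ V` induced by `f`. -/
abbrev localPullback (V : Opens Y) (W : Opens X) := ext V ⋙ pullbackRes f W

variable {f}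

/-- Supplies the preservation of colimits needed to carry presentations over `V` to presentations
over `W`. -/
lemma isLeftAdjoint_localPullback (h : W ≤ (Opens.map f.hom.base).obj V) :
    (localPullback f V W).IsLeftAdjoint :=
  (adjunctionOfIsIsoUnit (resExtAdj V) (pullbackResAdj f W)
    (isIso_unit_pushforward f V W h)).isLeftAdjoint

/-- The restriction of `f^* N` to `W` depends only on `N` over `V`, since the right adjoint takes
values in modules extended from `V`. -/
lemma isIso_pullbackRes_map_unit (h : W ≤ (Opens.map f.hom.base).obj V) (N : Mod Y) :
    IsIso ((pullbackRes f W).map ((resExtAdj V).unit.app N)) :=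
  isIso_map_unit_of_isIso_unit (resExtAdj V) (pullbackResAdj f W)
    (isIso_unit_pushforward f V W h) N

variable (f W) in
/-- The restriction of the inverse image of `𝒪_Y` to `W` is `𝒪_W`. -/
def pullbackResUnitIso : (pullbackRes f W).obj (SheafOfModules.unit _) ≅ SheafOfModules.unit _ :=
  (res W).mapIso (asIso (SheafOfModules.pullbackObjUnitToUnit (toRingCatSheafHom f)))

/-- The inverse image along `W ⟶ V` of `𝒪_V` is `𝒪_W`. -/
def localPullbackUnitIso (h : W ≤ (Opens.map f.hom.base).obj V) :
    SheafOfModules.unit _ ≅ (localPullback f V W).obj (SheafOfModules.unit _) :=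
  (pullbackResUnitIso f W).symm ≪≫
    @asIso _ _ _ _ _ (isIso_pullbackRes_map_unit h (SheafOfModules.unit _))

/-- The inverse image of a module which is presented over `V` is presented over any open subset
of `f ⁻¹ V`. -/
def pullbackPresentation (h : W ≤ (Opens.map f.hom.base).obj V) {N : Mod Y}
    (σ : (N.over V).Presentation) : (((pullback f).obj N).over W).Presentation :=
  haveI := isLeftAdjoint_localPullback h
  haveI := isIso_pullbackRes_map_unit h N
  (σ.map (localPullback f V W) (localPullbackUnitIso h)).ofIsIso
    (inv ((pullbackRes f W).map ((resExtAdj V).unit.app N)))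

end

lemma coversTop_map (f : X ⟶ Y) {I : Type*} {V : I → Opens Y}
    (h : (Opens.grothendieckTopology Y).CoversTop V) :
    (Opens.grothendieckTopology X).CoversTop fun i ↦ (Opens.map f.hom.base).obj (V i) := by
  intro W x hx
  obtain ⟨U, i, ⟨j, ⟨k⟩⟩, hU⟩ := h ⊤ (f.hom.base x) trivial
  exact ⟨W ⊓ (Opens.map f.hom.base).obj U, homOfLE inf_le_left,
    ⟨j, ⟨homOfLE (inf_le_right.trans ((Opens.map f.hom.base).map k).le)⟩⟩, hx, hU⟩

instance isQuasicoherent_pullback (f : X ⟶ Y) (N : Mod Y) [N.IsQuasicoherent] :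
    ((pullback f).obj N).IsQuasicoherent where
  nonempty_quasicoherentData :=
    let q := (SheafOfModules.IsQuasicoherent.nonempty_quasicoherentData (M := N)).some
    ⟨{ I := q.I
       X := fun i ↦ (Opens.map f.hom.base).obj (q.X i)
       coversTop := coversTop_map f q.coversTop
       presentation := fun i ↦ pullbackPresentation le_rfl (q.presentation i) }⟩

/-- Inverse image of quasi-coherent modules. -/
def qcohPullback (f : X ⟶ Y) : QCoh Y ⥤ QCoh X :=
  ObjectProperty.lift _ (ObjectProperty.ι _ ⋙ pullback f)
    (fun N ↦ isQuasicoherent_pullback f N.obj)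

end

end RingedFinite

/-! ### Detecting isomorphisms on presentations and covers -/

section

open Limits

/-- A natural transformation between functors which preserve the colimit of `F` is an isomorphism
at the colimit of `F` if it is so at each object of the diagram `F`. -/
lemma isIso_app_of_isColimit {J C D : Type*} [Category* J] [Category* C] [Category* D]
    {P Q : C ⥤ D} (β : P ⟶ Q) {F : J ⥤ C} {c : Cocone F} (hc : IsColimit c)
    [PreservesColimit F P] [PreservesColimit F Q] (h : ∀ j, IsIso (β.app (F.obj j))) :
    IsIso (β.app c.pt) := by
  have : IsIso (Functor.whiskerLeft F β) := by
    rw [NatTrans.isIso_iff_isIso_app]; exact h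
  have key : β.app c.pt = ((isColimitOfPreserves P hc).coconePointsIsoOfNatIso
      (isColimitOfPreserves Q hc) (asIso (Functor.whiskerLeft F β))).hom :=
    (isColimitOfPreserves P hc).hom_ext fun j ↦ by
      rw [IsColimit.comp_coconePointsIsoOfNatIso_hom]
      exact β.naturality (c.ι.app j)
  rw [key]
  infer_instance

lemma isIso_iff_of_comm_sq {C : Type*} [Category* C] {A B A' B' : C} {a : A ⟶ B} {b : A' ⟶ B'}
    {p : A ⟶ A'} {q : B ⟶ B'} [IsIso p] [IsIso q] (w : p ≫ b = a ≫ q) : IsIso a ↔ IsIso b := by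
  rw [← isIso_comp_left_iff p b, w, isIso_comp_right_iff]

variable {C : Type u} [SmallCategory C] {J : GrothendieckTopology C} {S : Sheaf J RingCat.{u}}
  [HasSheafify J AddCommGrpCat.{u}] [J.WEqualsLocallyBijective AddCommGrpCat.{u}]

/-- A natural transformation between colimit preserving functors on sheaves of modules
is an isomorphism at all modules with a presentation if it is so at the structure sheaf. -/
lemma SheafOfModules.Presentation.isIso_app {E : Type*} [Category* E]
    {P Q : SheafOfModules.{u} S ⥤ E} (β : P ⟶ Q)
    [PreservesColimitsOfSize.{u, u} P] [PreservesColimitsOfSize.{u, u} Q]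
    (h : IsIso (β.app (SheafOfModules.unit S))) {M : SheafOfModules.{u} S} (σ : M.Presentation) :
    IsIso (β.app M) := by
  have : PreservesColimitsOfSize.{0, 0} P := preservesColimitsOfSize_shrink _
  have : PreservesColimitsOfSize.{0, 0} Q := preservesColimitsOfSize_shrink _
  -- Free modules are coproducts of the structure sheaf, and a presentation exhibits `M` as a
  -- colimit of free modules.
  have hfree (I : Type u) : IsIso (β.app (SheafOfModules.free I)) :=
    isIso_app_of_isColimit β (SheafOfModules.isColimitFreeCofan I) fun _ ↦ h
  exact isIso_app_of_isColimit β σ.isColimit (by rintro (_ | _) <;> exact hfree _)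

omit [HasSheafify J AddCommGrpCat.{u}] [J.WEqualsLocallyBijective AddCommGrpCat.{u}] in
lemma SheafOfModules.isIso_of_coversTop {I : Type*} {X : I → C} (hX : J.CoversTop X)
    {M N : SheafOfModules.{u} S} (φ : M ⟶ N) (h : ∀ i, IsIso (φ.over (X i))) : IsIso φ := by
  have : IsIso ((SheafOfModules.toSheaf S).map φ) :=
    Sheaf.isIso_of_coversTop hX fun i ↦
      inferInstanceAs (IsIso ((SheafOfModules.toSheaf _).map (φ.over (X i))))
  have (U : Cᵒᵖ) : IsIso (φ.val.app U) := by
    have := (NatTrans.isIso_iff_isIso_app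
      ((sheafToPresheaf _ _).map ((SheafOfModules.toSheaf S).map φ))).1 inferInstance U
    rw [ConcreteCategory.isIso_iff_bijective] at this ⊢
    exact this
  exact SheafOfModules.isIso_of_isIso_app φ this

end

/-! ### Comparing inverse images along dominated morphisms -/

namespace RingedFinite

noncomputable section

variable {X Y Z : RingedSpace.{u, u}}

/-- For `f, g : X ⟶ Y`, the relation that each `f x` is a specialization of `g x`, and that
`f` on sections is `g` followed by restriction. -/
def Dominated (f g : X ⟶ Y) : Prop :=
  ∃ h : ∀ V : Opens Y, (Opens.map f.hom.base).obj V ≤ (Opens.map g.hom.base).obj V,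
    ∀ V, f.hom.c.app (op V) = g.hom.c.app (op V) ≫ X.presheaf.map (homOfLE (h V)).op

namespace Dominated

variable {f g : X ⟶ Y} (h : Dominated f g)

/-- The inclusions `f ⁻¹ V ⟶ g ⁻¹ V`. -/
def opensMap : Opens.map f.hom.base ⟶ Opens.map g.hom.base where
  app V := homOfLE (h.choose V)

include h in
lemma toRingCatSheafHom_comp : toRingCatSheafHom g ≫
    (Functor.sheafPushforwardContinuousNatTrans h.opensMap _ _ _).app (ringCatSheaf X) =
      toRingCatSheafHom f := by
  ext V : 3
  exact congr((forget₂ _ RingCat).map $(h.choose_spec V.unop)).symm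

/-- The comparison between direct images. -/
def pushforwardHom : pushforward g ⟶ pushforward f :=
  SheafOfModules.pushforwardNatTrans (toRingCatSheafHom g) h.opensMap ≫
    (SheafOfModules.pushforwardCongr h.toRingCatSheafHom_comp).hom

/-- The comparison between inverse images. -/
def pullbackHom : pullback f ⟶ pullback g :=
  (conjugateEquiv (pullbackPushforwardAdjunction g) (pullbackPushforwardAdjunction f)).symm
    h.pushforwardHom

lemma unitToPushforwardObjUnit_comp :
    SheafOfModules.unitToPushforwardObjUnit (toRingCatSheafHom g) ≫
      h.pushforwardHom.app _ =
    SheafOfModules.unitToPushforwardObjUnit (toRingCatSheafHom f) := by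
  ext V : 3
  refine LinearMap.ext fun x ↦ ?_
  exact congr($(h.choose_spec V.unop) x).symm

lemma pullbackHom_app_unit_comp :
    h.pullbackHom.app _ ≫ SheafOfModules.pullbackObjUnitToUnit (toRingCatSheafHom g) =
      SheafOfModules.pullbackObjUnitToUnit (toRingCatSheafHom f) := by
  apply ((pullbackPushforwardAdjunction f).homEquiv _ _).injective
  have e := unit_conjugateEquiv_symm (pullbackPushforwardAdjunction g)
    (pullbackPushforwardAdjunction f) h.pushforwardHom (SheafOfModules.unit _)
  have e' := h.pushforwardHom.naturality
    (SheafOfModules.pullbackObjUnitToUnit (toRingCatSheafHom g))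
  rw [SheafOfModules.pullbackPushforwardAdjunction_homEquiv_pullbackObjUnitToUnit,
    ← h.unitToPushforwardObjUnit_comp,
    ← SheafOfModules.pullbackPushforwardAdjunction_homEquiv_pullbackObjUnitToUnit,
    Adjunction.homEquiv_unit, Adjunction.homEquiv_unit, Functor.map_comp, Category.assoc, e',
    reassoc_of% e]
  rfl

/-- The comparison is compatible with the canonical maps from `f^* 𝒪_Y` and `g^* 𝒪_Y` to `𝒪_X`, both
isomorphisms. -/
instance : IsIso (h.pullbackHom.app (SheafOfModules.unit _)) := by
  have := h.pullbackHom_app_unit_comp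
  exact IsIso.of_isIso_fac_right this

variable (W : Opens X)

/-- The restriction to an open subset of the comparison between inverse images. -/
abbrev pullbackResHom : pullbackRes f W ⟶ pullbackRes g W :=
  Functor.whiskerRight h.pullbackHom (res W)

lemma isIso_pullbackResHom_app_iff {V : Opens Y} {W : Opens X}
    (hf : W ≤ (Opens.map f.hom.base).obj V) (M : Mod Y) :
    IsIso ((h.pullbackResHom W).app M) ↔
      IsIso ((h.pullbackResHom W).app ((ext V).obj ((res V).obj M))) := by
  have := isIso_pullbackRes_map_unit hf M
  have := isIso_pullbackRes_map_unit (hf.trans (h.choose V)) M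
  exact isIso_iff_of_comm_sq ((h.pullbackResHom W).naturality ((resExtAdj V).unit.app M))

lemma isIso_pullbackResHom_app {V : Opens Y} {W : Opens X}
    (hf : W ≤ (Opens.map f.hom.base).obj V) {N : Mod Y} (σ : (N.over V).Presentation) :
    IsIso ((h.pullbackResHom W).app N) := by
  rw [h.isIso_pullbackResHom_app_iff hf]
  have := isLeftAdjoint_localPullback hf
  have := isLeftAdjoint_localPullback (hf.trans (h.choose V))
  have hu : IsIso ((h.pullbackResHom W).app (SheafOfModules.unit _)) :=
    inferInstanceAs (IsIso ((res W).map (h.pullbackHom.app _)))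
  -- Presentations live over `V`, so the comparison is moved to functors on modules over `V`, where
  -- the colimit argument applies.
  let β : localPullback f V W ⟶ localPullback g V W :=
    Functor.whiskerLeft (ext V) (h.pullbackResHom W)
  have hβ : IsIso (β.app (SheafOfModules.unit _)) :=
    (h.isIso_pullbackResHom_app_iff hf (SheafOfModules.unit _)).1 hu
  have := σ.isIso_app β hβ
  exact this

lemma isIso_pullbackHom_app (N : Mod Y) [N.IsQuasicoherent] : IsIso (h.pullbackHom.app N) := by
  let q := (SheafOfModules.IsQuasicoherent.nonempty_quasicoherentData (M := N)).some
  exact SheafOfModules.isIso_of_coversTop (coversTop_map f q.coversTop) _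
    fun i ↦ h.isIso_pullbackResHom_app le_rfl (q.presentation i)

include h in
lemma nonempty_iso : Nonempty (qcohPullback f ≅ qcohPullback g) := by
  exact ⟨NatIso.ofComponents (fun N ↦ ObjectProperty.isoMk _ <|
      @asIso _ _ _ _ _ (@isIso_pullbackHom_app _ _ _ _ h N.obj N.property))
    fun φ ↦ by
      ext1
      exact h.pullbackHom.naturality φ.hom⟩

end Dominated

end

end RingedFinite

/-! ### Presheaf and sheaf inverse images -/

noncomputable section
section

variable {C D A : Type*} [Category* C] [Category* D] [Category* A] (G : C ⥤ D)
  {J : GrothendieckTopology C} (K : GrothendieckTopology D) [G.IsContinuous J K]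
  [∀ F : Cᵒᵖ ⥤ A, G.op.HasLeftKanExtension F] [HasWeakSheafify K A]

/-- The canonical morphism from the left Kan extension of a sheaf to its sheaf inverse image. -/
def lanToSheafPullback (F : Sheaf J A) :
    (G.op.lan).obj F.obj ⟶ ((G.sheafPullback A J K).obj F).obj :=
  toSheafify K _ ≫
    (((Functor.sheafPullbackConstruction.sheafAdjunctionContinuous G A J K).leftAdjointUniq
      (G.sheafAdjunctionContinuous A J K)).hom.app F).hom

/-- By uniqueness of left adjoints, this reduces to Kan extension followed by sheafification, whose
unit is the composite of the two units. -/
lemma lanUnit_comp_lanToSheafPullback (F : Sheaf J A) :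
    (G.op.lanAdjunction A).unit.app F.obj ≫ Functor.whiskerLeft G.op (lanToSheafPullback G K F) =
      ((G.sheafAdjunctionContinuous A J K).unit.app F).hom := by
  have h := Adjunction.unit_leftAdjointUniq_hom_app
    (Functor.sheafPullbackConstruction.sheafAdjunctionContinuous G A J K)
    (G.sheafAdjunctionContinuous A J K) F
  have h' := Adjunction.map_restrictFullyFaithful_unit_app
    (((G.op.lanAdjunction A).comp (sheafificationAdjunction K A)))
    (fullyFaithfulSheafToPresheaf J A) (Functor.FullyFaithful.id _)
    (L := Functor.sheafPullbackConstruction.sheafPullback G A J K)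
    (R := G.sheafPushforwardContinuous A J K) (Iso.refl _) (Iso.refl _) F
  have h'' :
      ((Functor.sheafPullbackConstruction.sheafAdjunctionContinuous G A J K).unit.app F).hom =
      (G.op.lanAdjunction A).unit.app F.obj ≫ Functor.whiskerLeft G.op (toSheafify K _) := by
    refine h'.trans ?_
    rw [Adjunction.comp_unit_app, Category.assoc]
    change _ ≫ _ ≫ 𝟙 _ ≫ 𝟙 _ = _
    rw [Category.comp_id]
    exact congrArg ((G.op.lanAdjunction A).unit.app F.obj ≫ ·)
      (Category.comp_id (Functor.whiskerLeft G.op (toSheafify K _)))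
  rw [← h, ObjectProperty.FullSubcategory.comp_hom, h'']
  exact (Category.assoc ((G.op.lanAdjunction A).unit.app F.obj)
    (Functor.whiskerLeft G.op (toSheafify K _))
    (Functor.whiskerLeft G.op
      (((Functor.sheafPullbackConstruction.sheafAdjunctionContinuous G A J K).leftAdjointUniq
        (G.sheafAdjunctionContinuous A J K)).hom.app F).hom)).symm

instance isLocallySurjective_lanToSheafPullback {FA : A → A → Type*} {CA : A → Type*}
    [∀ X Y, FunLike (FA X Y) (CA X) (CA Y)] [ConcreteCategory A FA]
    [K.WEqualsLocallyBijective A] [HasSheafify K A] (F : Sheaf J A) :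
    Presheaf.IsLocallySurjective K (lanToSheafPullback G K F) := by
  let e := ((Functor.sheafPullbackConstruction.sheafAdjunctionContinuous G A J K).leftAdjointUniq
    (G.sheafAdjunctionContinuous A J K)).hom.app F
  let e' : sheafify K (G.op.lan.obj F.obj) ⟶ ((G.sheafPullback A J K).obj F).obj := e.hom
  have : IsIso e' := inferInstanceAs (IsIso ((sheafToPresheaf K A).map e))
  exact Presheaf.isLocallySurjective_comp K (toSheafify K (G.op.lan.obj F.obj)) e'

end

namespace TopCat.Sheaf

variable {X Y : TopCat.{u}} (f : X ⟶ Y) (F : TopCat.Sheaf CommRingCat.{u} Y)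

/-- The canonical morphism from the presheaf inverse image to the sheaf inverse image. -/
def presheafPullbackHom :
    (TopCat.Presheaf.pullback CommRingCat.{u} f).obj F.presheaf ⟶
      ((TopCat.Sheaf.pullback CommRingCat.{u} f).obj F).presheaf :=
  lanToSheafPullback (Opens.map f) (Opens.grothendieckTopology X) F

lemma unit_comp_presheafPullbackHom (V : Opens Y) :
    ((TopCat.Presheaf.pullbackPushforwardAdjunction CommRingCat.{u} f).unit.app F.presheaf).app
        (op V) ≫ (presheafPullbackHom f F).app (op ((Opens.map f).obj V)) =
      ((TopCat.Sheaf.pullbackPushforwardAdjunction CommRingCat.{u} f).unit.app F).hom.app (op V) :=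
  congr($(lanUnit_comp_lanToSheafPullback (Opens.map f) (Opens.grothendieckTopology X) F).app
    (op V))

lemma presheafPullbackHom_hom_ext {W : Opens X} {Z : CommRingCat.{u}}
    {φ ψ : ((TopCat.Sheaf.pullback CommRingCat.{u} f).obj F).presheaf.obj (op W) ⟶ Z}
    (h : ∀ (V : Opens Y) (hV : W ≤ (Opens.map f).obj V),
      ((TopCat.Sheaf.pullbackPushforwardAdjunction CommRingCat.{u} f).unit.app F).hom.app (op V) ≫
        ((TopCat.Sheaf.pullback CommRingCat.{u} f).obj F).presheaf.map (homOfLE hV).op ≫ φ =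
      ((TopCat.Sheaf.pullbackPushforwardAdjunction CommRingCat.{u} f).unit.app F).hom.app (op V) ≫
        ((TopCat.Sheaf.pullback CommRingCat.{u} f).obj F).presheaf.map (homOfLE hV).op ≫ ψ) :
    (presheafPullbackHom f F).app (op W) ≫ φ = (presheafPullbackHom f F).app (op W) ≫ ψ := by
  refine TopCat.Presheaf.pullback_obj_obj_ext (op W) fun V hV ↦ ?_
  simp only [(presheafPullbackHom f F).naturality_assoc]
  have := h V hV
  rw [← unit_comp_presheafPullbackHom] at this
  exact this

lemma exists_presheafPullbackHom_eq {W : Opens X}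
    (σ : ((TopCat.Sheaf.pullback CommRingCat.{u} f).obj F).presheaf.obj (op W))
    {x : X} (hx : x ∈ W) :
    ∃ (W' : Opens X) (i : W' ⟶ W) (_ : x ∈ W')
      (τ : ((TopCat.Presheaf.pullback CommRingCat.{u} f).obj F.presheaf).obj (op W')),
      (presheafPullbackHom f F).app (op W') τ =
        ((TopCat.Sheaf.pullback CommRingCat.{u} f).obj F).presheaf.map i.op σ := by
  have : CategoryTheory.Presheaf.IsLocallySurjective (Opens.grothendieckTopology X)
      (presheafPullbackHom f F) :=
    isLocallySurjective_lanToSheafPullback (Opens.map f) (Opens.grothendieckTopology X) F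
  obtain ⟨W', i, ⟨τ, hτ⟩, hx'⟩ :=
    CategoryTheory.Presheaf.imageSieve_mem (Opens.grothendieckTopology X)
      (presheafPullbackHom f F) σ x hx
  exact ⟨W', i, hx', τ, hτ⟩

end TopCat.Sheaf

/-! ### Germs of sections on `X × I` -/

namespace RingedFinite

variable (X : RingedSpace.{u, u})

lemma unit_comp_cylInclSharp (t : unitInterval) (V : Opens X) :
    ((TopCat.Sheaf.pullbackPushforwardAdjunction CommRingCat.{u} (cylProj X)).unit.app
        X.sheaf).hom.app (op V) ≫
      (cylInclSharp X t).hom.app (op ((Opens.map (cylProj X)).obj V)) = 𝟙 _ := by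
  have h : (TopCat.Sheaf.pullbackPushforwardAdjunction CommRingCat.{u} (cylProj X)).unit.app
        X.sheaf ≫ (TopCat.Sheaf.pushforward CommRingCat.{u} (cylProj X)).map
      (cylInclSharp X t) = 𝟙 X.sheaf :=
    (Adjunction.homEquiv_unit ..).symm.trans (Equiv.apply_symm_apply _ _)
  exact congr(($h).hom.app (op V))

/-- The germ at `x` of the restriction of a section on `X × I` to `X × {t}`. -/
def cylGerm (W : Opens (cylTop X)) (x : X) (t : unitInterval) (h : (x, t) ∈ W) :
    ((TopCat.Sheaf.pullback CommRingCat.{u} (cylProj X)).obj X.sheaf).presheaf.obj (op W) ⟶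
      X.presheaf.stalk x :=
  (cylInclSharp X t).hom.app (op W) ≫ X.presheaf.germ ((Opens.map (cylIncl X t)).obj W) x h

lemma map_comp_cylGerm {W W' : Opens (cylTop X)} (i : W' ⟶ W) (x : X) (t : unitInterval)
    (h : (x, t) ∈ W') :
    ((TopCat.Sheaf.pullback CommRingCat.{u} (cylProj X)).obj X.sheaf).presheaf.map i.op ≫
      cylGerm X W' x t h = cylGerm X W x t (i.le h) := by
  have h₁ := (cylInclSharp X t).hom.naturality i.op
  have h₂ := X.presheaf.germ_res ((Opens.map (cylIncl X t)).map i) x h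
  refine .trans (Category.assoc _ _ _).symm (.trans congr($h₁ ≫ _) ?_)
  exact .trans (Category.assoc _ _ _) congr((cylInclSharp X t).hom.app (op W) ≫ $h₂)

lemma unit_comp_cylGerm (V : Opens X) (x : X) (t : unitInterval) (h : x ∈ V) :
    ((TopCat.Sheaf.pullbackPushforwardAdjunction CommRingCat.{u} (cylProj X)).unit.app
        X.sheaf).hom.app (op V) ≫ cylGerm X ((Opens.map (cylProj X)).obj V) x t h =
      X.presheaf.germ V x h :=
  .trans (Category.assoc _ _ _).symm
    (.trans congr($(unit_comp_cylInclSharp X t V) ≫ _) (Category.id_comp _))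

/-- Sections of the presheaf inverse image come from opens of `X`, and their germs there do not
involve `t`. -/
lemma presheafPullbackHom_comp_cylGerm (W : Opens (cylTop X)) (x : X) {t t' : unitInterval}
    (h : (x, t) ∈ W) (h' : (x, t') ∈ W) :
    (TopCat.Sheaf.presheafPullbackHom (cylProj X) X.sheaf).app (op W) ≫ cylGerm X W x t h =
      (TopCat.Sheaf.presheafPullbackHom (cylProj X) X.sheaf).app (op W) ≫
        cylGerm X W x t' h' := by
  refine TopCat.Sheaf.presheafPullbackHom_hom_ext _ _ fun V hV ↦ ?_
  have key (t : unitInterval) (h : (x, t) ∈ W) :=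
    congr(((TopCat.Sheaf.pullbackPushforwardAdjunction CommRingCat.{u} (cylProj X)).unit.app
      X.sheaf).hom.app (op V) ≫ $(map_comp_cylGerm X (homOfLE hV) x t h)).trans
        (unit_comp_cylGerm X V x t (hV h))
  exact (key t h).trans (key t' h').symm

variable {X}

/-- Near `(x, t)` the section lifts to the presheaf inverse image, where germs are independent of
`t`. -/
lemma eventually_cylGerm_eq {W : Opens (cylTop X)}
    (σ : ((TopCat.Sheaf.pullback CommRingCat.{u} (cylProj X)).obj X.sheaf).presheaf.obj (op W))
    {x : X} {t : unitInterval} (h : (x, t) ∈ W) :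
    ∀ᶠ t' in nhds t, ∀ h' : (x, t') ∈ W, cylGerm X W x t h σ = cylGerm X W x t' h' σ := by
  obtain ⟨W', i, hx', τ, hτ⟩ :=
    TopCat.Sheaf.exists_presheafPullbackHom_eq (cylProj X) X.sheaf σ h
  have : ∀ᶠ t' in nhds t, (x, t') ∈ W' :=
    (Continuous.prodMk_right x).continuousAt.eventually_mem (W'.isOpen.mem_nhds hx')
  filter_upwards [this] with t' ht' h'
  rw [← map_comp_cylGerm X i x t hx', ← map_comp_cylGerm X i x t' ht',
    ConcreteCategory.comp_apply, ConcreteCategory.comp_apply, ← hτ]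
  exact congr($(presheafPullbackHom_comp_cylGerm X W' x hx' ht') τ)

/-- The germs of a section along a connected subset of `{x} × I` are all equal. -/
lemma cylGerm_eq_of_isPreconnected {W : Opens (cylTop X)}
    (σ : ((TopCat.Sheaf.pullback CommRingCat.{u} (cylProj X)).obj X.sheaf).presheaf.obj (op W))
    {x : X} {J : Set unitInterval} (hJ : _root_.IsPreconnected J) (h : ∀ t ∈ J, (x, t) ∈ W)
    {t t' : unitInterval} (ht : t ∈ J) (ht' : t' ∈ J) :
    cylGerm X W x t (h t ht) σ = cylGerm X W x t' (h t' ht') σ := by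
  refine hJ.induction₂ (fun t t' ↦ ∀ (ht : (x, t) ∈ W) (ht' : (x, t') ∈ W),
    cylGerm X W x t ht σ = cylGerm X W x t' ht' σ) (fun t ht ↦ ?_)
    (fun t₁ t₂ t₃ _ h₂ _ h₁₂ h₂₃ h₁ h₃ ↦ (h₁₂ h₁ (h _ h₂)).trans (h₂₃ _ _))
    (fun t₁ t₂ _ _ h₁₂ h₂ h₁ ↦ (h₁₂ h₁ h₂).symm) ht ht' _ _
  filter_upwards [mem_nhdsWithin_of_mem_nhds (eventually_cylGerm_eq σ (h t ht))] with t' h' _ h''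
  exact h' h''

end RingedFinite

end

/-! ### Homotopy invariance -/

namespace RingedFinite

noncomputable section

variable {X Y Z : RingedSpace.{u, u}}

lemma incl_comp_c_app_comp_germ (H : cyl X ⟶ Y) (t : unitInterval) (V : Opens Y) (x : X)
    (h : H.hom.base (x, t) ∈ V) :
    (incl X t ≫ H).hom.c.app (op V) ≫
        X.presheaf.germ ((Opens.map (incl X t ≫ H).hom.base).obj V) x h =
      H.hom.c.app (op V) ≫ cylGerm X ((Opens.map H.hom.base).obj V) x t h :=
  Category.assoc _ _ _

/-- The members of a homotopy between ringed finite spaces are locally comparable. -/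
lemma eventually_dominated_incl_comp [Finite X.carrier] [Finite Y.carrier] (H : cyl X ⟶ Y)
    (t : unitInterval) : ∀ᶠ t' in nhds t, Dominated (incl X t ≫ H) (incl X t' ≫ H) := by
  -- The smallest neighbourhood of `H (x, t)`, open because `Y` is finite.
  let N (x : X) : Set Y := nhdsKer {H.hom.base (x, t)}
  have hN : {t' | ∀ x, H.hom.base (x, t') ∈ N x} ∈ nhds t := by
    refine Filter.eventually_all.2 fun x ↦ ?_
    have hc : Continuous fun t' : unitInterval ↦ H.hom.base (x, t') :=
      H.hom.base.hom.continuous.comp (Continuous.prodMk_right x)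
    exact hc.continuousAt.eventually_mem (isOpen_nhdsKer.mem_nhds (subset_nhdsKer rfl))
  -- Shrinking to an interval around `t` keeps `{x} × J` inside `H⁻¹ V`, so germs can be transported
  -- from `t` to `t'`.
  have hJ := Set.ordConnectedComponent_mem_nhds.2 hN
  filter_upwards [hJ] with t' ht'
  have hV (V : Opens Y) (x : X) (hx : H.hom.base (x, t) ∈ V) {t'' : unitInterval}
      (h : t'' ∈ Set.ordConnectedComponent {t' | ∀ x, H.hom.base (x, t') ∈ N x} t) :
      H.hom.base (x, t'') ∈ V :=
    nhdsKer_minimal (Set.singleton_subset_iff.2 hx) V.isOpen (Set.ordConnectedComponent_subset h x)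
  refine ⟨fun V x hx ↦ hV V x hx ht', fun V ↦ ?_⟩
  ext s
  refine TopCat.Presheaf.section_ext X.sheaf _ _ _ fun x hx ↦ ?_
  have h₁ := congr($(incl_comp_c_app_comp_germ H t V x hx) s)
  have h₂ := congr($(incl_comp_c_app_comp_germ H t' V x (hV V x hx ht')) s)
  have h₃ := cylGerm_eq_of_isPreconnected (W := (Opens.map H.hom.base).obj V) (x := x)
    (H.hom.c.app (op V) s) (J := Set.ordConnectedComponent _ t)
    (Set.OrdConnected.isPreconnected inferInstance)
    (fun t'' h ↦ hV V x hx h) (mem_of_mem_nhds hJ) ht'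
  refine (h₁.trans h₃).trans (h₂.symm.trans ?_)
  exact (X.presheaf.germ_res_apply (homOfLE fun x hx ↦ hV V x hx ht') x hx _).symm

lemma Homotopic.nonempty_iso [Finite X.carrier] [Finite Y.carrier] {f g : X ⟶ Y}
    (h : Homotopic f g) : Nonempty (qcohPullback f ≅ qcohPullback g) := by
  obtain ⟨H, rfl, rfl⟩ := h
  let P (t t' : unitInterval) : Prop :=
    Nonempty (qcohPullback (incl X t ≫ H) ≅ qcohPullback (incl X t' ≫ H))
  -- Domination is directed, but the isomorphisms it yields can be inverted, as the connectedness
  -- argument requires.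
  have : Std.Symm P := ⟨fun _ _ ⟨e⟩ ↦ ⟨e.symm⟩⟩
  exact PreconnectedSpace.induction₂ P
    (fun t ↦ (eventually_dominated_incl_comp H t).mono fun _ h ↦ h.nonempty_iso)
    ⟨fun _ _ _ ⟨e⟩ ⟨e'⟩ ↦ ⟨e ≪≫ e'⟩⟩ 0 1

/-- Inverse image of quasi-coherent modules along the identity. -/
def qcohPullbackId : qcohPullback (𝟙 X) ≅ 𝟭 (QCoh X) :=
  NatIso.ofComponents (fun N ↦ ObjectProperty.isoMk _ (pullbackId.app N.obj)) fun φ ↦ by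
    ext1
    exact pullbackId.hom.naturality φ.hom

/-- Inverse image of quasi-coherent modules along a composition. -/
def qcohPullbackComp (f : X ⟶ Y) (g : Y ⟶ Z) :
    qcohPullback g ⋙ qcohPullback f ≅ qcohPullback (f ≫ g) :=
  NatIso.ofComponents (fun N ↦ ObjectProperty.isoMk _ ((pullbackComp f g).app N.obj)) fun φ ↦ by
    ext1
    exact (pullbackComp f g).hom.naturality φ.hom

lemma nonempty_iso_of_homotopic_id [Finite X.carrier] {f : X ⟶ Y} {g : Y ⟶ X}
    (h : Homotopic (f ≫ g) (𝟙 X)) : Nonempty (qcohPullback g ⋙ qcohPullback f ≅ 𝟭 (QCoh X)) :=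
  h.nonempty_iso.map fun e ↦ qcohPullbackComp f g ≪≫ e ≪≫ qcohPullbackId

end

end RingedFinite

/-- Homotopy equivalent ringed finite spaces have equivalent categories of quasi-coherent
modules. -/
theorem mainTheorem2 (X Y : AlgebraicGeometry.RingedSpace.{u, u})
    (hX : RingedFinite.IsRingedFiniteSpace X) (hY : RingedFinite.IsRingedFiniteSpace Y)
    (h : RingedFinite.HomotopyEquivalent X Y) :
    Nonempty (RingedFinite.QCoh X ≌ RingedFinite.QCoh Y) := by
  obtain ⟨f, g, hfg, hgf⟩ := h
  obtain ⟨e⟩ := RingedFinite.nonempty_iso_of_homotopic_id hfg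
  obtain ⟨e'⟩ := RingedFinite.nonempty_iso_of_homotopic_id hgf
  exact ⟨CategoryTheory.Equivalence.mk (RingedFinite.qcohPullback g) (RingedFinite.qcohPullback f)
    e.symm e'⟩
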